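/- Let $C\subset\mathbb R^2$ be a convex set, with the topology induced from the plane. Let $\exp(C)$ be the set of all nonempty compact subsets of $C$ with the Vietoris topology, that is, the topology with subbase consisting of the sets $\{K\in\exp(C):K\subset U\}$ and $\{K\in\exp(C):K\cap U\neq\emptyset\}$, where $U$ runs over the open subsets of $C$. Then $C$ is compactly convex: there exists a continuous map $\Phi:C\to\exp(C)$ such that $$[x,y]\subset\Phi(x)\cup\Phi(y)\qquad\text{for all }x,y\in C,$$ where $[x,y]=\{(1-t)x+ty:0\le t\le 1\}$. -/

import Mathlib

/-- A subset `C` of a real topological vector space is compactly convex if it is convex and there is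
a map `Φ` from `C` to the hyperspace of nonempty compact subsets of `C`, continuous for the
Vietoris topology (this is the topology that Mathlib puts on `NonemptyCompacts`), such that
`[x, y] ⊆ Φ x ∪ Φ y` for all `x, y ∈ C`. -/
def IsCompactlyConvex {E : Type*} [AddCommGroup E] [Module ℝ E] [TopologicalSpace E]
    (C : Set E) : Prop :=
  Convex ℝ C ∧ ∃ Φ : C → TopologicalSpace.NonemptyCompacts C, Continuous Φ ∧
    ∀ x y : C, segment ℝ (x : E) (y : E) ⊆
      (Subtype.val '' (Φ x : Set C)) ∪ (Subtype.val '' (Φ y : Set C))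

/-! Homogenize: let `K` be the cone over `C × {1}` in a three-dimensional space, and send `x` to the
unit vector `n x` on its ray. The unit vectors of the closure of `K` form a compact set `Y`, even
when `C` is unbounded or not closed. Suppose that `M u v ∈ [u, v] ∩ K` can be chosen symmetrically
and continuously when `u`, `v` lie in the closure and one of them in `K`. Let `Φ x` be the radial
projection to `C` of all segments `[n x, M (n x) v]`, `v ∈ Y`. It is compact and continuous in `x`,
and symmetry makes `M (n x) (n y)` cut `[n x, n y]` into a half covered by `Φ x` and a half covered
by `Φ y`.

The choice of `M` is a selection problem for intervals that need not be closed. It is solved by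
inserting a continuous function between the endpoint functions, strictly where they differ. This
needs lower semicontinuity of `[u, v] ∩ K` (`eventually_exists_combo_mem`), and here dimension three
enters. If `u + v` is interior to `K`, so is the whole open segment. Otherwise, for independent `u`,
`v`, a supporting plane at `u + v` is spanned by `u` and `v`; nearby pairs either stay in that
plane, a two-dimensional problem, or have an interior sum. -/

open Set Filter Topology
open scoped Pointwise

/-! ### Insertion and selection for semicontinuous interval maps -/

/-- A nonnegative lower semicontinuous function on a metric space is the limit of an increasing sequence
of continuous functions lying strictly below it. -/
theorem LowerSemicontinuous.exists_monotone_continuous_lt {X : Type*} [PseudoMetricSpace X]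
    {b : X → ℝ} (hb : LowerSemicontinuous b) (hb0 : ∀ p, 0 ≤ b p) :
    ∃ l : ℕ → X → ℝ, (∀ n, Continuous (l n)) ∧ (∀ p, Monotone fun n => l n p) ∧
      (∀ n p, l n p < b p) ∧ (∀ p, ∀ c < b p, ∃ n, c < l n p) := by
  have bdd : ∀ (n : ℕ) (p : X), BddBelow (range fun q => b q + n * dist p q) := fun n p =>
    ⟨0, by rintro _ ⟨q, rfl⟩; have := hb0 q; positivity⟩
  -- Infimal convolution of `b` with `n * dist` is `n`-Lipschitz; subtracting `1 / (n + 1)` makes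
  -- the bound strict.
  refine ⟨fun n p => (⨅ q, (b q + n * dist p q)) - 1 / ((n : ℝ) + 1), fun n => ?_, fun p => ?_,
    fun n p => ?_, fun p c hc => ?_⟩
  · refine Continuous.sub ?_ continuous_const
    refine (LipschitzWith.of_le_add_mul (n : NNReal) fun p p' => ?_).continuous
    have : Nonempty X := ⟨p⟩
    rw [← sub_le_iff_le_add]
    refine le_ciInf fun q => ?_
    have h1 : (⨅ q, (b q + n * dist p q)) ≤ b q + n * dist p q := ciInf_le (bdd n p) q
    have h2 : (n : ℝ) * dist p q ≤ n * (dist p p' + dist p' q) :=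
      mul_le_mul_of_nonneg_left (dist_triangle _ _ _) (Nat.cast_nonneg n)
    simp only [NNReal.coe_natCast]
    linarith
  · have : Nonempty X := ⟨p⟩
    refine monotone_nat_of_le_succ fun n => sub_le_sub ?_ ?_
    · refine le_ciInf fun q => (ciInf_le (bdd n p) q).trans ?_
      gcongr
      simp
    · apply one_div_le_one_div_of_le <;> push_cast <;> linarith [(Nat.cast_nonneg n : (0 : ℝ) ≤ n)]
  · have h1 : (⨅ q, (b q + n * dist p q)) ≤ b p + n * dist p p := ciInf_le (bdd n p) p
    have h2 : 0 < 1 / ((n : ℝ) + 1) := by positivity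
    simp only [dist_self, mul_zero, add_zero] at h1
    simp only
    linarith
  · have : Nonempty X := ⟨p⟩
    obtain ⟨c', hc', hc'b⟩ := exists_between hc
    obtain ⟨ε, hε, hball⟩ := Metric.eventually_nhds_iff.1 (hb p c' hc'b)
    obtain ⟨n, hn⟩ := exists_nat_gt (max (c' / ε) (1 / (c' - c)))
    refine ⟨n, ?_⟩
    have hn0 : (0 : ℝ) < n := (one_div_pos.2 (sub_pos.2 hc')).trans ((le_max_right _ _).trans_lt hn)
    have h1 : c' ≤ ⨅ q, (b q + n * dist p q) := by
      refine le_ciInf fun q => ?_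
      by_cases hq : dist q p < ε
      · have := hball hq
        have : 0 ≤ (n : ℝ) * dist p q := by positivity
        linarith
      · have h2 : c' < n * ε := (div_lt_iff₀ hε).1 ((le_max_left _ _).trans_lt hn)
        have h3 : (n : ℝ) * ε ≤ n * dist p q := by
          rw [dist_comm p q]
          exact mul_le_mul_of_nonneg_left (not_lt.1 hq) hn0.le
        linarith [hb0 q]
    have h4 : 1 / ((n : ℝ) + 1) < c' - c := by
      rw [div_lt_comm₀ (by positivity) (sub_pos.2 hc')]
      exact ((le_max_right _ _).trans_lt hn).trans (lt_add_one _)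
    simp only
    linarith

/-- Insertion of a continuous function between semicontinuous functions `a ≤ b`, strictly wherever
`a < b`. -/
theorem exists_continuous_between {X : Type*} [PseudoMetricSpace X] {a b : X → ℝ}
    (ha : UpperSemicontinuous a) (hb : LowerSemicontinuous b) (ha0 : ∀ p, 0 ≤ a p)
    (hab : ∀ p, a p ≤ b p) (hb1 : ∀ p, b p ≤ 1) :
    ∃ f : X → ℝ, Continuous f ∧ ∀ p, (a p < f p ∧ f p < b p) ∨ (f p = a p ∧ f p = b p) := by
  obtain ⟨l', hl'c, hl'm, hl'b, hl't⟩ :=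
    hb.exists_monotone_continuous_lt fun p => (ha0 p).trans (hab p)
  obtain ⟨w, hwc, hwm, hwb, hwt⟩ :=
    LowerSemicontinuous.exists_monotone_continuous_lt (b := fun p => 1 - a p)
      (by
        intro p c hc
        filter_upwards [ha p (1 - c) (by linarith)] with q hq
        linarith)
      (fun p => by linarith [hab p, hb1 p])
  -- Since `u 0 > a ≥ 0`, lowering `l 0` to at most `-1` ensures `l 0 < u 0`, so a first crossing
  -- has index `n + 1`.
  obtain ⟨l, hl⟩ : ∃ l : ℕ → X → ℝ, l = fun n p => if n = 0 then min (l' 0 p) (-1) else l' n p :=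
    ⟨_, rfl⟩
  obtain ⟨u, hu⟩ : ∃ u : ℕ → X → ℝ, u = fun n p => 1 - w n p := ⟨_, rfl⟩
  have hlc : ∀ n, Continuous (l n) := by
    intro n
    rcases eq_or_ne n 0 with rfl | hn
    · simpa [hl] using (hl'c 0).min continuous_const
    · simpa [hl, hn] using hl'c n
  have huc : ∀ n, Continuous (u n) := fun n => by
    rw [hu]; exact continuous_const.sub (hwc n)
  have hll' : ∀ n p, l n p ≤ l' n p := by
    intro n p
    rcases eq_or_ne n 0 with rfl | hn
    · simp [hl]
    · simp [hl, hn]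
  have hlm : ∀ p, Monotone fun n => l n p := by
    intro p
    refine monotone_nat_of_le_succ fun n => ?_
    refine (hll' n p).trans ((hl'm p n.le_succ).trans ?_)
    simp [hl]
  have hlb : ∀ n p, l n p < b p := fun n p => (hll' n p).trans_lt (hl'b n p)
  have hlt : ∀ p, ∀ c < b p, ∃ n, c < l n p := by
    intro p c hc
    obtain ⟨n, hn⟩ := hl't p c hc
    exact ⟨n + 1, hn.trans_le ((hl'm p n.le_succ).trans (by simp [hl]))⟩
  have hum : ∀ p, Antitone fun n => u n p := by
    intro p m n hmn
    have := hwm p hmn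
    simp only [hu] at this ⊢
    linarith
  have hua : ∀ n p, a p < u n p := by
    intro n p
    have := hwb n p
    simp only [hu]
    linarith
  have hut : ∀ p, ∀ c > a p, ∃ n, u n p < c := by
    intro p c hc
    obtain ⟨n, hn⟩ := hwt p (1 - c) (by linarith)
    exact ⟨n, by simp only [hu]; linarith⟩
  have hl0 : ∀ p, l 0 p < u 0 p := by
    intro p
    have h1 : l 0 p ≤ -1 := by simp [hl]
    linarith [hua 0 p, ha0 p]
  have bdd : ∀ p, BddAbove (range fun n => min (l n p) (u n p)) := fun p =>
    ⟨b p, by rintro _ ⟨n, rfl⟩; exact (min_le_left _ _).trans (hlb n p).le⟩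
  -- A supremum of continuous functions is lower semicontinuous; the bounds `hupp` give upper
  -- semicontinuity, being sharp at the first crossing.
  obtain ⟨f, hf⟩ : ∃ f : X → ℝ, f = fun p => ⨆ n, min (l n p) (u n p) := ⟨_, rfl⟩
  have hlow : ∀ n p, min (l n p) (u n p) ≤ f p := fun n p => by
    rw [hf]; exact le_ciSup (bdd p) n
  have hupp : ∀ n p, f p ≤ max (u (n + 1) p) (l n p) := by
    intro n p
    rw [hf]
    refine ciSup_le fun k => ?_
    rcases le_or_gt k n with hk | hk
    · exact (min_le_left _ _).trans ((hlm p hk).trans (le_max_right _ _))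
    · exact (min_le_right _ _).trans ((hum p hk).trans (le_max_left _ _))
  have key : ∀ p, (∃ n, f p = max (u (n + 1) p) (l n p) ∧ u (n + 1) p ≤ l (n + 1) p) ∨
      (f p = a p ∧ f p = b p) := by
    intro p
    by_cases hN : ∃ n, u n p ≤ l n p
    · left
      classical
      obtain ⟨N, hN1, hN2⟩ : ∃ N, u N p ≤ l N p ∧ ∀ k < N, l k p < u k p :=
        ⟨Nat.find hN, Nat.find_spec hN, fun k hk => not_le.1 (Nat.find_min hN hk)⟩
      rcases N with _ | n
      · exact absurd hN1 (not_le.2 (hl0 p))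
      refine ⟨n, le_antisymm (hupp n p) (max_le ?_ ?_), hN1⟩
      · exact (min_eq_right hN1).symm.le.trans (hlow _ p)
      · exact (min_eq_left (hN2 n n.lt_succ_self).le).symm.le.trans (hlow _ p)
    -- Without a crossing, `l n < u n` for all `n` squeezes `b ≤ a`.
    · right
      push Not at hN
      have h1 : b p ≤ f p := by
        refine le_of_forall_lt fun c hc => ?_
        obtain ⟨n, hn⟩ := hlt p c hc
        exact hn.trans_le ((min_eq_left (hN n).le).symm.le.trans (hlow n p))
      have h2 : f p ≤ b p := by
        rw [hf]; exact ciSup_le fun n => (min_le_left _ _).trans (hlb n p).le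
      have h3 : b p ≤ a p := by
        refine le_of_forall_gt fun c hc => ?_
        obtain ⟨n, hn⟩ := hut p c hc
        refine lt_of_le_of_lt ?_ hn
        refine le_of_forall_lt fun d hd => ?_
        obtain ⟨m, hm⟩ := hlt p d hd
        calc d < l m p := hm
          _ ≤ l (max m n) p := hlm p (le_max_left _ _)
          _ < u (max m n) p := hN _
          _ ≤ u n p := hum p (le_max_right _ _)
      have := hab p
      exact ⟨by linarith, by linarith⟩
  refine ⟨f, ?_, fun p => ?_⟩
  · rw [continuous_iff_lower_upperSemicontinuous]
    constructor
    · intro p c hc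
      obtain ⟨n, hn⟩ := exists_lt_of_lt_ciSup (f := fun n => min (l n p) (u n p))
        (by simpa [hf] using hc)
      filter_upwards [((hlc n).min (huc n)).continuousAt.eventually (lt_mem_nhds hn)] with q hq
      exact hq.trans_le (hlow n q)
    · intro p c hc
      obtain ⟨n, hn⟩ : ∃ n, max (u (n + 1) p) (l n p) < c := by
        rcases key p with ⟨n, hn, -⟩ | ⟨h1, h2⟩
        · exact ⟨n, hn ▸ hc⟩
        · obtain ⟨n, hn⟩ := hut p c (by rw [← h1]; exact hc)
          exact ⟨n, max_lt ((hum p n.le_succ).trans_lt hn) ((hlb n p).trans (by rw [← h2]; exact hc))⟩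
      filter_upwards [((huc (n + 1)).max (hlc n)).continuousAt.eventually (gt_mem_nhds hn)] with q hq
      exact (hupp n q).trans_lt hq
  · rcases key p with ⟨n, hn, hn'⟩ | h
    · left
      rw [hn]
      exact ⟨lt_max_of_lt_left (hua _ p), max_lt (hn'.trans_lt (hlb _ p)) (hlb _ p)⟩
    · exact Or.inr h

/-- A lower semicontinuous multifunction from a metric space to the nonempty subintervals of `[0, 1]`
has a continuous selection. -/
theorem exists_continuous_selection_Icc {X : Type*} [PseudoMetricSpace X] {F : X → Set ℝ}
    (hF : ∀ p, F p ⊆ Icc 0 1) (hne : ∀ p, (F p).Nonempty) (hconn : ∀ p, (F p).OrdConnected)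
    (hlsc : ∀ p, ∀ r ∈ F p, ∀ ε > 0, ∀ᶠ q in 𝓝 p, ∃ s ∈ F q, |s - r| < ε) :
    ∃ f : X → ℝ, Continuous f ∧ ∀ p, f p ∈ F p := by
  have hbb : ∀ p, BddBelow (F p) := fun p => bddBelow_Icc.mono (hF p)
  have hba : ∀ p, BddAbove (F p) := fun p => bddAbove_Icc.mono (hF p)
  obtain ⟨f, hfc, hf⟩ := exists_continuous_between (a := fun p => sInf (F p))
    (b := fun p => sSup (F p))
    (by
      intro p c hc
      obtain ⟨r, hr, hrc⟩ := exists_lt_of_csInf_lt (hne p) hc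
      filter_upwards [hlsc p r hr (c - r) (sub_pos.2 hrc)] with q hq
      obtain ⟨s, hs, hsr⟩ := hq
      exact (csInf_le (hbb q) hs).trans_lt (by linarith [(abs_lt.1 hsr).2]))
    (by
      intro p c hc
      obtain ⟨r, hr, hrc⟩ := exists_lt_of_lt_csSup (hne p) hc
      filter_upwards [hlsc p r hr (r - c) (sub_pos.2 hrc)] with q hq
      obtain ⟨s, hs, hsr⟩ := hq
      exact lt_of_lt_of_le (by linarith [(abs_lt.1 hsr).1]) (le_csSup (hba q) hs))
    (fun p => le_csInf (hne p) fun r hr => (hF p hr).1)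
    (fun p => csInf_le_csSup (hne p) (hbb p) (hba p))
    (fun p => csSup_le (hne p) fun r hr => (hF p hr).2)
  refine ⟨f, hfc, fun p => ?_⟩
  rcases hf p with ⟨h1, h2⟩ | ⟨h1, h2⟩
  · obtain ⟨r, hr, hr'⟩ := exists_lt_of_csInf_lt (hne p) h1
    obtain ⟨s, hs, hs'⟩ := exists_lt_of_lt_csSup (hne p) h2
    exact (hconn p).out hr hs ⟨hr'.le, hs'.le⟩
  · obtain ⟨r, hr⟩ := hne p
    have : f p = r := le_antisymm (h1.le.trans (csInf_le (hbb p) hr))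
      ((le_csSup (hba p) hr).trans h2.ge)
    rwa [this]

/-! ### Vietoris continuity of compact ranges -/

/-- The range of `G x`, where `G` is jointly continuous and its second argument runs through a
compact space, depends continuously on `x` in the Vietoris topology. -/
theorem TopologicalSpace.NonemptyCompacts.exists_continuous_range {X Y Z : Type*}
    [TopologicalSpace X] [TopologicalSpace Y] [TopologicalSpace Z] [CompactSpace Z] [Nonempty Z]
    {G : X → Z → Y} (hG : Continuous (Function.uncurry G)) :
    ∃ Φ : X → TopologicalSpace.NonemptyCompacts Y, Continuous Φ ∧
      ∀ x, (Φ x : Set Y) = range (G x) := by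
  have hGx : ∀ x, Continuous (G x) := fun x => hG.comp (Continuous.prodMk_right x)
  refine ⟨fun x => ⟨⟨range (G x), isCompact_range (hGx x)⟩, range_nonempty _⟩, ?_, fun x => rfl⟩
  let _ : TopologicalSpace (Set Y) := TopologicalSpace.vietoris Y
  rw [isEmbedding_coe.continuous_iff, TopologicalSpace.vietoris.continuous_iff]
  constructor
  · intro U hU
    rw [isOpen_iff_mem_nhds]
    intro x hx
    have hx' : ∀ z, G x z ∈ U := fun z => hx ⟨z, rfl⟩
    have := isCompact_univ.eventually_forall_of_forall_eventually (x₀ := x)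
      (P := fun x z => G x z ∈ U) (K := (univ : Set Z))
      (fun z _ => (hU.preimage hG).mem_nhds (hx' z))
    filter_upwards [this] with x' hx''
    rintro _ ⟨z, rfl⟩
    exact hx'' z (mem_univ z)
  · intro F hF
    have : (fun x => range (G x)) ⁻¹' F.powerset = ⋂ z, (fun x => G x z) ⁻¹' F := by
      ext x
      simp [range_subset_iff]
    exact this ▸ isClosed_iInter fun z => hF.preimage (hG.comp (Continuous.prodMk_left z))

/-! ### Segments meeting a convex cone: lower semicontinuity -/

namespace ConvexCone

section Topological

variable {V : Type*} [AddCommGroup V] [Module ℝ V] [TopologicalSpace V] [ContinuousSMul ℝ V]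
  (K : ConvexCone ℝ V)

theorem smul_mem_interior {c : ℝ} (hc : 0 < c) {x : V} (hx : x ∈ interior (K : Set V)) :
    c • x ∈ interior (K : Set V) := by
  have h : c • (K : Set V) ⊆ K := by
    rintro _ ⟨y, hy, rfl⟩
    exact K.smul_mem hc hy
  refine interior_mono h ?_
  rw [interior_smul₀ hc.ne']
  exact smul_mem_smul_set hx

variable [IsTopologicalAddGroup V]

/-- Divided by `c + 1`, the vector is a convex combination of a closure point and an interior point.
-/
theorem smul_add_mem_interior {c : ℝ} (hc : 0 ≤ c) {x y : V} (hx : x ∈ closure (K : Set V))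
    (hy : y ∈ interior (K : Set V)) : c • x + y ∈ interior (K : Set V) := by
  have h := K.convex.combo_closure_interior_mem_interior hx hy (a := c / (c + 1)) (b := 1 / (c + 1))
    (by positivity) (by positivity) (by field_simp)
  convert K.smul_mem_interior (c := c + 1) (by positivity) h using 1
  rw [smul_add, smul_smul, smul_smul]
  field_simp
  simp

/-- If the sum of two points of the closure is interior, so is every point strictly between them. -/
theorem combo_mem_interior {x y : V} (hx : x ∈ closure (K : Set V)) (hy : y ∈ closure (K : Set V))
    (hxy : x + y ∈ interior (K : Set V)) {s : ℝ} (hs0 : 0 < s) (hs1 : s < 1) :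
    (1 - s) • x + s • y ∈ interior (K : Set V) := by
  -- Split off the symmetric part, `s • (x + y)` or `(1 - s) • (x + y)`; the rest is a nonnegative
  -- multiple of `x` or of `y`.
  rcases le_total s (1 / 2) with h | h
  · convert K.smul_add_mem_interior (c := 1 - 2 * s) (by linarith) hx
      (K.smul_mem_interior hs0 hxy) using 1
    module
  · convert K.smul_add_mem_interior (c := 2 * s - 1) (by linarith) hy
      (K.smul_mem_interior (sub_pos.2 hs1) hxy) using 1
    module

end Topological

/-- The planar case of lower semicontinuity of `(u, v) ↦ [u, v] ∩ K`. -/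
theorem exists_combo_mem_of_coords_near {V : Type*} [AddCommGroup V] [Module ℝ V]
    (K : ConvexCone ℝ V) {u₀ v₀ : V} {s₀ : ℝ}
    (hs₀ : s₀ ∈ Icc (0 : ℝ) 1) (hK₀ : (1 - s₀) • u₀ + s₀ • v₀ ∈ K) (h₀ : u₀ ∈ K ∨ v₀ ∈ K)
    {ε : ℝ} (hε : 0 < ε) :
    ∃ δ > 0, ∀ a b c d : ℝ, |a - 1| < δ → |b| < δ → |c| < δ → |d - 1| < δ →
      (a • u₀ + b • v₀ ∈ K ∨ c • u₀ + d • v₀ ∈ K) →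
      ∃ s ∈ Icc (0 : ℝ) 1, (1 - s) • (a • u₀ + b • v₀) + s • (c • u₀ + d • v₀) ∈ K ∧
        |s - s₀| < ε := by
  -- Either `s₀` lies in a nondegenerate parameter interval with both ends in `K`, or it is the only
  -- parameter giving a point of `K`.
  by_cases hJ : ∃ r₁ r₂ : ℝ, 0 ≤ r₁ ∧ r₁ < r₂ ∧ r₂ ≤ 1 ∧ r₁ ≤ s₀ ∧ s₀ ≤ r₂ ∧
      (1 - r₁) • u₀ + r₁ • v₀ ∈ K ∧ (1 - r₂) • u₀ + r₂ • v₀ ∈ K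
  · obtain ⟨r₁, r₂, hr₁, hr, hr₂, h1, h2, hK₁, hK₂⟩ := hJ
    obtain ⟨r, ⟨hr1, hr2⟩, hrs⟩ : ∃ r ∈ Ioo r₁ r₂, dist s₀ r < ε := by
      have : s₀ ∈ closure (Ioo r₁ r₂) := by rw [closure_Ioo hr.ne]; exact ⟨h1, h2⟩
      exact Metric.mem_closure_iff.1 this ε hε
    refine ⟨min (r - r₁) (r₂ - r), lt_min (by linarith) (by linarith), ?_⟩
    intro a b c d ha hb hc hd _
    refine ⟨r, ⟨by linarith, by linarith⟩, ?_, by rwa [abs_sub_comm, ← Real.dist_eq]⟩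
    have hδ1 := min_le_left (r - r₁) (r₂ - r)
    have hδ2 := min_le_right (r - r₁) (r₂ - r)
    have hδ0 : 0 < min (r - r₁) (r₂ - r) := lt_min (by linarith) (by linarith)
    generalize min (r - r₁) (r₂ - r) = δ at *
    rw [abs_lt] at ha hb hc hd
    have hr0 : 0 < r := by linarith
    have hr1' : 0 < 1 - r := by linarith
    obtain ⟨A, hA⟩ : ∃ A, A = (1 - r) * a + r * c := ⟨_, rfl⟩
    obtain ⟨B, hB⟩ : ∃ B, B = (1 - r) * b + r * d := ⟨_, rfl⟩
    have hA1 : 1 - r - δ < A := by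
      linarith [mul_pos hr1' (show 0 < a - 1 + δ by linarith), mul_pos hr0 (show 0 < c + δ by linarith)]
    have hA2 : A < 1 - r + δ := by
      linarith [mul_pos hr1' (show 0 < δ - (a - 1) by linarith), mul_pos hr0 (show 0 < δ - c by linarith)]
    have hB1 : r - δ < B := by
      linarith [mul_pos hr1' (show 0 < b + δ by linarith), mul_pos hr0 (show 0 < d - 1 + δ by linarith)]
    have hB2 : B < r + δ := by
      linarith [mul_pos hr1' (show 0 < δ - b by linarith), mul_pos hr0 (show 0 < δ - (d - 1) by linarith)]
    -- By Cramer's rule these are the coordinates of `A • u₀ + B • v₀` in the vectors at parameters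
    -- `r₁` and `r₂`; the choice of `δ` makes them positive.
    have hc1 : 0 < (r₂ * A - (1 - r₂) * B) / (r₂ - r₁) := by
      apply div_pos _ (by linarith)
      linarith [mul_pos (show 0 < r₂ by linarith) (sub_pos.2 hA1),
        mul_nonneg (sub_nonneg.2 hr₂) (sub_pos.2 hB2).le]
    have hc2 : 0 < ((1 - r₁) * B - r₁ * A) / (r₂ - r₁) := by
      apply div_pos _ (by linarith)
      linarith [mul_pos (show 0 < 1 - r₁ by linarith) (sub_pos.2 hB1),
        mul_nonneg hr₁ (sub_pos.2 hA2).le]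
    have hmem := K.add_mem (K.smul_mem hc1 hK₁) (K.smul_mem hc2 hK₂)
    have hne : r₂ - r₁ ≠ 0 := by linarith
    have e1 : (r₂ * A - (1 - r₂) * B) / (r₂ - r₁) * (1 - r₁) +
        ((1 - r₁) * B - r₁ * A) / (r₂ - r₁) * (1 - r₂) = A := by field_simp; ring
    have e2 : (r₂ * A - (1 - r₂) * B) / (r₂ - r₁) * r₁ +
        ((1 - r₁) * B - r₁ * A) / (r₂ - r₁) * r₂ = B := by field_simp; ring
    convert hmem using 1
    trans A • u₀ + B • v₀
    · rw [hA, hB]; module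
    · generalize (r₂ * A - (1 - r₂) * B) / (r₂ - r₁) = x at e1 e2 ⊢
      generalize ((1 - r₁) * B - r₁ * A) / (r₂ - r₁) = y at e1 e2 ⊢
      rw [← e1, ← e2]
      module
  · have huniq : ∀ r : ℝ, 0 ≤ r → r ≤ 1 → (1 - r) • u₀ + r • v₀ ∈ K → r = s₀ := by
      intro r h0 h1 hr
      by_contra hne
      rcases lt_or_gt_of_ne hne with h | h
      · exact hJ ⟨r, s₀, h0, h, hs₀.2, h.le, le_rfl, hr, hK₀⟩
      · exact hJ ⟨s₀, r, hs₀.1, h, h1, le_rfl, h.le, hK₀, hr⟩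
    have hratio : ∀ x y : ℝ, 0 < x → 0 < y → x • u₀ + y • v₀ ∈ K → y / (x + y) = s₀ := by
      intro x y hx hy h
      have hxy : 0 < x + y := by linarith
      refine huniq _ (by positivity) ((div_le_one hxy).2 (by linarith)) ?_
      convert K.smul_mem (inv_pos.2 hxy) h using 1
      rw [smul_add, smul_smul, smul_smul]
      congr 2 <;> field_simp
      ring
    refine ⟨1 / 2, by norm_num, ?_⟩
    intro a b c d ha hb hc hd h
    rw [abs_lt] at ha hb hc hd
    rcases h₀ with h₀ | h₀
    · have hs : s₀ = 0 := (huniq 0 le_rfl zero_le_one (by simpa using h₀)).symm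
      rcases h with h | h
      · exact ⟨0, ⟨le_rfl, zero_le_one⟩, by simpa using h, by simpa [hs] using hε⟩
      -- If the perturbed `v₀` were in `K`, adding `u₀` would give a second parameter, strictly
      -- between 0 and 1.
      · have h' : (1 + c) • u₀ + d • v₀ ∈ K := by
          convert K.add_mem h₀ h using 1
          module
        have := hratio _ _ (by linarith) (by linarith) h'
        have h3 : 0 < d / (1 + c + d) := div_pos (by linarith) (by linarith)
        linarith
    · have hs : s₀ = 1 := (huniq 1 zero_le_one le_rfl (by simpa using h₀)).symm
      rcases h with h | h
      · have h' : a • u₀ + (1 + b) • v₀ ∈ K := by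
          convert K.add_mem h h₀ using 1
          module
        have := hratio _ _ (by linarith) (by linarith) h'
        have h3 : (1 + b) / (a + (1 + b)) < 1 := (div_lt_one (by linarith)).2 (by linarith)
        linarith
      · exact ⟨1, ⟨zero_le_one, le_rfl⟩, by simpa using h, by simpa [hs] using hε⟩

section Normed

variable {V : Type*} [NormedAddCommGroup V] [NormedSpace ℝ V] [FiniteDimensional ℝ V]
  (K : ConvexCone ℝ V)

/-- A nonempty convex cone without interior points lies in a hyperplane. -/
theorem exists_ne_zero_forall_eq_zero (hne : (K : Set V).Nonempty)
    (hint : interior (K : Set V) = ∅) :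
    ∃ g : V →L[ℝ] ℝ, g ≠ 0 ∧ ∀ x ∈ K, g x = 0 := by
  have h1 : affineSpan ℝ (K : Set V) ≠ ⊤ := by
    intro h
    have := K.convex.interior_nonempty_iff_affineSpan_eq_top.2 h
    rw [hint] at this
    exact not_nonempty_empty this
  have h2 : vectorSpan ℝ (K : Set V) < ⊤ := by
    rw [lt_top_iff_ne_top, ← direction_affineSpan]
    rwa [Ne, AffineSubspace.direction_eq_top_iff_of_nonempty ((affineSpan_nonempty ℝ).2 hne)]
  obtain ⟨f, hf, hle⟩ := Submodule.exists_le_ker_of_lt_top _ h2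
  refine ⟨LinearMap.toContinuousLinearMap f, by simpa using hf, fun x hx => ?_⟩
  -- The difference `2x - x = x` shows that the direction space contains the cone itself.
  have h3 : (2 : ℝ) • x -ᵥ x ∈ vectorSpan ℝ (K : Set V) :=
    vsub_mem_vectorSpan ℝ (K.smul_mem two_pos hx) hx
  have h4 := hle h3
  rw [vsub_eq_sub, two_smul, add_sub_cancel_right] at h4
  simpa using h4

/-- A supporting functional at `u + v`, together with a vector on which it is negative. -/
theorem exists_supporting {u v : V} (hu : u ∈ closure (K : Set V)) (hv : v ∈ closure (K : Set V))
    (huv : u + v ∉ interior (K : Set V)) :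
    ∃ (g : V →L[ℝ] ℝ) (q : V), g u = 0 ∧ g v = 0 ∧ g q < 0 ∧
      (∀ x ∈ closure (K : Set V), g x ≤ 0) ∧
      ((∀ x ∈ closure (K : Set V), g x = 0) ∨ q ∈ interior (K : Set V)) := by
  rcases (interior (K : Set V)).eq_empty_or_nonempty with hint | ⟨q, hq⟩
  · obtain ⟨g, hg, hgK⟩ :=
      K.exists_ne_zero_forall_eq_zero (closure_nonempty_iff.1 ⟨u, hu⟩) hint
    have hcl : ∀ x ∈ closure (K : Set V), g x = 0 := fun x hx =>
      closure_minimal (fun y hy => hgK y hy) (isClosed_singleton.preimage g.continuous) hx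
    obtain ⟨q, hq⟩ : ∃ q, g q < 0 := by
      by_contra! h
      refine hg (ContinuousLinearMap.ext fun x => le_antisymm ?_ (h x))
      have := h (-x)
      simp only [map_neg, zero_apply] at this ⊢
      linarith
    exact ⟨g, q, hcl u hu, hcl v hv, hq, fun x hx => (hcl x hx).le, Or.inl hcl⟩
  · obtain ⟨g, hg⟩ := geometric_hahn_banach_open_point K.convex.interior isOpen_interior huv
    -- Scaling forces `g ≤ 0` on the interior and `g (u + v) ≥ 0`, hence `g u = g v = 0`.
    have hscale : ∀ x ∈ interior (K : Set V), ∀ t : ℝ, 0 < t → t * g x < g (u + v) := by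
      intro x hx t ht
      simpa using hg _ (K.smul_mem_interior ht hx)
    have hle : ∀ x ∈ interior (K : Set V), g x ≤ 0 := by
      intro x hx
      by_contra! h
      have hw := hg x hx
      have := hscale x hx (g (u + v) / g x) (div_pos (h.trans hw) h)
      rw [div_mul_cancel₀ _ h.ne'] at this
      exact lt_irrefl _ this
    have hcl : ∀ x ∈ closure (K : Set V), g x ≤ 0 := by
      rw [← K.convex.closure_interior_eq_closure_of_nonempty_interior ⟨q, hq⟩]
      exact fun x hx => closure_minimal (fun y hy => hle y hy) (isClosed_Iic.preimage g.continuous) hx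
    have hw : 0 ≤ g (u + v) := by
      by_contra! h
      have hq' := hg q hq
      have := hscale q hq (g (u + v) / g q) (div_pos_of_neg_of_neg h (hq'.trans h))
      rw [div_mul_cancel₀ _ (hq'.trans h).ne] at this
      exact lt_irrefl _ this
    have hgu := hcl u hu
    have hgv := hcl v hv
    rw [map_add] at hw
    have hgq := hg q hq
    rw [map_add] at hgq
    exact ⟨g, q, by linarith, by linarith, by linarith, hcl, Or.inr hq⟩

/-- In dimension three, independent `u, v` in the closure of `K` whose sum is not interior extend
to a basis whose last coordinate is nonnegative on `K`. -/
theorem exists_basis_coord_nonneg (hdim : Module.finrank ℝ V = 3) {u v : V}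
    (hu : u ∈ closure (K : Set V)) (hv : v ∈ closure (K : Set V))
    (hli : LinearIndependent ℝ ![u, v]) (huv : u + v ∉ interior (K : Set V)) :
    ∃ b : Module.Basis (Fin 3) ℝ V, b 0 = u ∧ b 1 = v ∧
      (∀ x ∈ closure (K : Set V), 0 ≤ b.coord 2 x) ∧
      ((∀ x ∈ closure (K : Set V), b.coord 2 x = 0) ∨ b 2 ∈ interior (K : Set V)) := by
  obtain ⟨g, q, hgu, hgv, hgq, hle, hor⟩ := K.exists_supporting hu hv huv
  have hli3 : LinearIndependent ℝ ![u, v, q] := by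
    rw [Fintype.linearIndependent_iff]
    intro c hc
    simp only [Fin.sum_univ_three, Matrix.cons_val] at hc
    have h2 : c 2 = 0 := by
      have := congrArg g hc
      simp only [map_add, map_smul, hgu, hgv, mul_zero, zero_add, map_zero,
        smul_eq_mul] at this
      exact (mul_eq_zero.1 this).resolve_right hgq.ne
    rw [h2, zero_smul, add_zero] at hc
    obtain ⟨h0, h1⟩ := LinearIndependent.pair_iff.1 hli _ _ hc
    intro i
    fin_cases i <;> assumption
  let b : Module.Basis (Fin 3) ℝ V := basisOfLinearIndependentOfCardEqFinrank hli3 (by simp [hdim])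
  have hb : ∀ i, b i = ![u, v, q] i := fun i => by simp [b]
  have h0 : b 0 = u := hb 0
  have h1 : b 1 = v := hb 1
  have h2 : b 2 = q := hb 2
  have hg : ∀ x, g x = b.coord 2 x * g q := by
    intro x
    conv_lhs => rw [← b.sum_repr x, Fin.sum_univ_three, h0, h1, h2]
    simp only [map_add, map_smul, hgu, hgv, smul_eq_mul, mul_zero, zero_add]
    rfl
  refine ⟨b, h0, h1, fun x hx => ?_, ?_⟩
  · have := hle x hx
    rw [hg] at this
    exact nonneg_of_mul_nonpos_left this hgq
  · rw [h2]
    refine hor.imp_left fun h x hx => ?_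
    have := h x hx
    rw [hg] at this
    exact (mul_eq_zero.1 this).resolve_right hgq.ne

/-- In dimension three, `(u, v) ↦ [u, v] ∩ K` is lower semicontinuous on the pairs of independent
vectors of the closure of `K` at least one of which is in `K`. -/
theorem eventually_exists_combo_mem (hdim : Module.finrank ℝ V = 3) {u₀ v₀ : V}
    (hu₀ : u₀ ∈ closure (K : Set V)) (hv₀ : v₀ ∈ closure (K : Set V))
    (hli : LinearIndependent ℝ ![u₀, v₀]) (h₀ : u₀ ∈ K ∨ v₀ ∈ K) {s₀ : ℝ}
    (hs₀ : s₀ ∈ Icc (0 : ℝ) 1) (hK₀ : (1 - s₀) • u₀ + s₀ • v₀ ∈ K) {ε : ℝ} (hε : 0 < ε) :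
    ∀ᶠ p : V × V in 𝓝 (u₀, v₀), p.1 ∈ closure (K : Set V) → p.2 ∈ closure (K : Set V) →
      (p.1 ∈ K ∨ p.2 ∈ K) →
      ∃ s ∈ Icc (0 : ℝ) 1, (1 - s) • p.1 + s • p.2 ∈ K ∧ |s - s₀| < ε := by
  have hgood : ∀ p : V × V, p.1 ∈ closure (K : Set V) → p.2 ∈ closure (K : Set V) →
      p.1 + p.2 ∈ interior (K : Set V) →
      ∃ s ∈ Icc (0 : ℝ) 1, (1 - s) • p.1 + s • p.2 ∈ K ∧ |s - s₀| < ε := by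
    intro p h1 h2 h3
    have : s₀ ∈ closure (Ioo (0 : ℝ) 1) := by rwa [closure_Ioo zero_ne_one]
    obtain ⟨s, hs, hss⟩ := Metric.mem_closure_iff.1 this ε hε
    exact ⟨s, Ioo_subset_Icc_self hs, interior_subset (K.combo_mem_interior h1 h2 h3 hs.1 hs.2),
      by rwa [abs_sub_comm, ← Real.dist_eq]⟩
  have hadd : Continuous fun p : V × V => p.1 + p.2 := continuous_add
  by_cases huv : u₀ + v₀ ∈ interior (K : Set V)
  · filter_upwards [(isOpen_interior.preimage hadd).mem_nhds
      (show ((u₀, v₀) : V × V) ∈ _ from huv)] with p hp h1 h2 _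
    exact hgood p h1 h2 hp
  obtain ⟨b, hb0, hb1, hnn, hor⟩ := K.exists_basis_coord_nonneg hdim hu₀ hv₀ hli huv
  obtain ⟨δ, hδ, hplane⟩ := K.exists_combo_mem_of_coords_near hs₀ hK₀ h₀ hε
  have hc : ∀ i, Continuous (b.coord i) := fun i => LinearMap.continuous_of_finiteDimensional _
  have hev : ∀ f : V × V → ℝ, Continuous f → ∀ r : ℝ, f (u₀, v₀) = r → ∀ η > 0,
      ∀ᶠ p in 𝓝 ((u₀, v₀) : V × V), |f p - r| < η := by
    intro f hf r hr η hη
    have := hf.tendsto (u₀, v₀)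
    rw [hr] at this
    exact this (Metric.ball_mem_nhds r hη)
  have e00 : b.coord 0 u₀ = 1 := by rw [← hb0]; simp
  have e10 : b.coord 1 u₀ = 0 := by rw [← hb0]; simp
  have e01 : b.coord 0 v₀ = 0 := by rw [← hb1]; simp
  have e11 : b.coord 1 v₀ = 1 := by rw [← hb1]; simp
  -- The bound `1 / 2` keeps the summed `u₀` and `v₀` coordinates of the pair positive.
  have hm : 0 < min δ (1 / 2) := lt_min hδ (by norm_num)
  filter_upwards [hev (fun p => b.coord 0 p.1) ((hc 0).comp continuous_fst) 1 e00 _ hm,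
    hev (fun p => b.coord 1 p.1) ((hc 1).comp continuous_fst) 0 e10 _ hm,
    hev (fun p => b.coord 0 p.2) ((hc 0).comp continuous_snd) 0 e01 _ hm,
    hev (fun p => b.coord 1 p.2) ((hc 1).comp continuous_snd) 1 e11 _ hm]
    with p p00 p10 p01 p11 h1 h2 hK
  rw [sub_zero] at p10 p01
  have hsum : ∀ x, x = b.coord 0 x • u₀ + b.coord 1 x • v₀ + b.coord 2 x • b 2 := by
    intro x
    conv_lhs => rw [← b.sum_repr x, Fin.sum_univ_three, hb0, hb1]
    rfl
  -- Third coordinates are nonnegative: sum zero puts both vectors in the plane of `u₀`, `v₀`; a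
  -- positive sum adds a positive multiple of the interior vector `b 2`.
  rcases (add_nonneg (hnn _ h1) (hnn _ h2)).eq_or_lt with h | h
  · have z1 : b.coord 2 p.1 = 0 := by linarith [hnn _ h1, hnn _ h2]
    have z2 : b.coord 2 p.2 = 0 := by linarith [hnn _ h1, hnn _ h2]
    have q1 := hsum p.1
    have q2 := hsum p.2
    rw [z1, zero_smul, add_zero] at q1
    rw [z2, zero_smul, add_zero] at q2
    have := hplane _ _ _ _ (lt_min_iff.1 p00).1 (lt_min_iff.1 p10).1 (lt_min_iff.1 p01).1
      (lt_min_iff.1 p11).1 (by rwa [← q1, ← q2])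
    rwa [← q1, ← q2] at this
  · have hq : b 2 ∈ interior (K : Set V) :=
      hor.resolve_left fun h' => by rw [h' _ h1, h' _ h2] at h; simp at h
    refine hgood p h1 h2 ?_
    have p00' := abs_lt.1 (lt_min_iff.1 p00).2
    have p10' := abs_lt.1 (lt_min_iff.1 p10).2
    have p01' := abs_lt.1 (lt_min_iff.1 p01).2
    have p11' := abs_lt.1 (lt_min_iff.1 p11).2
    convert K.smul_add_mem_interior (c := b.coord 0 p.1 + b.coord 0 p.2) (by linarith) hu₀
      (K.smul_add_mem_interior (c := b.coord 1 p.1 + b.coord 1 p.2) (by linarith) hv₀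
        (K.smul_mem_interior h hq)) using 1
    conv_lhs => rw [hsum p.1, hsum p.2]
    module

end Normed

end ConvexCone

/-! ### Symmetric continuous selection -/

namespace ConvexCone

/-- Pairs of vectors of the closure of `K`, at least one of them in `K`, that are either linearly
independent or equal. -/
def selectionDomain {V : Type*} [AddCommGroup V] [Module ℝ V] [TopologicalSpace V]
    (K : ConvexCone ℝ V) : Set (V × V) :=
  {p | p.1 ∈ closure (K : Set V) ∧ p.2 ∈ closure (K : Set V) ∧ (p.1 ∈ K ∨ p.2 ∈ K) ∧
    (LinearIndependent ℝ ![p.1, p.2] ∨ p.1 = p.2)}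

variable {V : Type*} [NormedAddCommGroup V] [NormedSpace ℝ V] [FiniteDimensional ℝ V]
  (K : ConvexCone ℝ V)

/-- For a convex cone `K` in dimension three, a point of `[u, v] ∩ K` can be chosen symmetrically in
`u, v` and continuously. -/
theorem exists_symmetric_selection (hdim : Module.finrank ℝ V = 3) :
    ∃ M : V → V → V, (∀ u v, M u v = M v u) ∧
      (∀ u v, ∃ s ∈ Icc (0 : ℝ) 1, M u v = (1 - s) • u + s • v) ∧
      (∀ u v, (u, v) ∈ K.selectionDomain → M u v ∈ K) ∧
      ContinuousOn (Function.uncurry M) K.selectionDomain := by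
  let P : Set (V × V) := {p | p.1 ∈ closure (K : Set V) ∧ p.2 ∈ closure (K : Set V) ∧
    (p.1 ∈ K ∨ p.2 ∈ K) ∧ LinearIndependent ℝ ![p.1, p.2]}
  have hPswap : ∀ u v, (u, v) ∈ P → (v, u) ∈ P := fun u v h =>
    ⟨h.2.1, h.1, h.2.2.1.symm, LinearIndependent.pair_symm_iff.1 h.2.2.2⟩
  let F : P → Set ℝ := fun p => {s | s ∈ Icc (0 : ℝ) 1 ∧ (1 - s) • p.1.1 + s • p.1.2 ∈ K}
  obtain ⟨f, hfc, hf⟩ := exists_continuous_selection_Icc (F := F) (fun p s hs => hs.1)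
    (fun p => by
      rcases p.2.2.2.1 with h | h
      · exact ⟨0, ⟨le_rfl, zero_le_one⟩, by simpa using h⟩
      · exact ⟨1, ⟨zero_le_one, le_rfl⟩, by simpa using h⟩)
    (fun p => by
      refine Convex.ordConnected ?_
      intro s hs t ht a b ha hb hab
      refine ⟨convex_Icc 0 1 hs.1 ht.1 ha hb hab, ?_⟩
      rw [← SetLike.mem_coe]
      convert K.convex hs.2 ht.2 ha hb hab using 1
      obtain rfl : a = 1 - b := by linarith
      simp only [smul_eq_mul]
      module)
    (fun p s hs ε hε => by
      have := K.eventually_exists_combo_mem hdim p.2.1 p.2.2.1 p.2.2.2.2 p.2.2.2.1 hs.1 hs.2 hε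
      filter_upwards [continuous_subtype_val.continuousAt.eventually this] with q hq
      obtain ⟨t, ht, htK, hts⟩ := hq q.2.1 q.2.2.1 q.2.2.2.1
      exact ⟨t, ⟨ht, htK⟩, hts⟩)
  classical
  -- The default `1 / 2` only keeps `τ` in `[0, 1]` off `P`.
  let τ : V × V → ℝ := fun p => if h : p ∈ P then f ⟨p, h⟩ else 1 / 2
  have hτ : ∀ p, τ p ∈ Icc (0 : ℝ) 1 := by
    intro p
    by_cases h : p ∈ P
    · simpa only [τ, dif_pos h] using (hf ⟨p, h⟩).1
    · simp only [τ, dif_neg h]; norm_num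
  have hτc : ContinuousOn τ P := by
    have h : P.domRestrict τ = f := funext fun p => dif_pos p.2
    rwa [continuousOn_iff_continuous_domRestrict, h]
  -- The averaging gives `σ v u = 1 - σ u v`, hence the symmetry of `M`.
  let σ : V → V → ℝ := fun u v => (τ (u, v) + (1 - τ (v, u))) / 2
  have hσ : ∀ u v, σ u v ∈ Icc (0 : ℝ) 1 := by
    intro u v
    have h1 := hτ (u, v)
    have h2 := hτ (v, u)
    constructor <;> simp only [σ] <;> linarith [h1.1, h1.2, h2.1, h2.2]
  let M : V → V → V := fun u v => (1 - σ u v) • u + σ u v • v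
  have hMP : ContinuousOn (Function.uncurry M) P := by
    have hswap : ContinuousOn (fun p : V × V => τ (p.2, p.1)) P :=
      hτc.comp continuous_swap.continuousOn fun p hp => hPswap p.1 p.2 hp
    have hσc : ContinuousOn (fun p : V × V => σ p.1 p.2) P :=
      (hτc.add (continuousOn_const.sub hswap)).div_const 2
    exact ((continuousOn_const.sub hσc).smul continuousOn_fst).add (hσc.smul continuousOn_snd)
  refine ⟨M, fun u v => ?_, fun u v => ⟨σ u v, hσ u v, rfl⟩, fun u v huv => ?_, ?_⟩
  · simp only [M, σ]
    module
  · obtain ⟨h1, h2, h3, h4 | h4⟩ := huv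
    · have hP : (u, v) ∈ P := ⟨h1, h2, h3, h4⟩
      have hP' := hPswap u v hP
      have k1 := (hf ⟨(u, v), hP⟩).2
      have k2 := (hf ⟨(v, u), hP'⟩).2
      have k := K.convex k1 k2 (a := 1 / 2) (b := 1 / 2) (by norm_num) (by norm_num) (by norm_num)
      rw [← SetLike.mem_coe]
      convert k using 1
      simp only [M, σ, τ, dif_pos hP, dif_pos hP']
      module
    · simp only at h4
      subst h4
      have : M u u = u := by simp only [M]; module
      rw [this]
      exact h3.elim id id
  · rintro ⟨u, v⟩ huv
    by_cases hne : u = v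
    · subst hne
      have hM : M u u = u := by simp only [M]; module
      -- Near the diagonal `τ` may be discontinuous, but `M u v` lies on `[u, v]`, which shrinks to
      -- a point.
      have hle : ∀ p : V × V, dist (Function.uncurry M p) p.1 ≤ dist p.2 p.1 := by
        intro p
        have : M p.1 p.2 - p.1 = σ p.1 p.2 • (p.2 - p.1) := by simp only [M]; module
        rw [Function.uncurry, dist_eq_norm, this, norm_smul, Real.norm_eq_abs,
          abs_of_nonneg (hσ _ _).1, dist_eq_norm]
        exact mul_le_of_le_one_left (norm_nonneg _) (hσ _ _).2
      refine ContinuousAt.continuousWithinAt ?_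
      have h1 : Tendsto (fun p : V × V => dist p.2 p.1) (𝓝 (u, u)) (𝓝 0) := by
        simpa using (continuous_snd.dist continuous_fst).tendsto ((u, u) : V × V)
      have h2 := squeeze_zero (fun p => dist_nonneg) hle h1
      have h3 : Tendsto (fun p : V × V => p.1) (𝓝 (u, u)) (𝓝 u) := continuous_fst.tendsto (u, u)
      have h4 : Tendsto (Function.uncurry M) (𝓝 (u, u)) (𝓝 u) := by
        refine tendsto_of_tendsto_of_dist h3 ?_
        simpa only [dist_comm] using h2
      simpa only [ContinuousAt, Function.uncurry, hM] using! h4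
    · have hP : (u, v) ∈ P := ⟨huv.1, huv.2.1, huv.2.2.1, huv.2.2.2.resolve_right hne⟩
      refine (hMP (u, v) hP).mono_of_mem_nhdsWithin ?_
      have hopen : {p : V × V | p.1 ≠ p.2} ∈ 𝓝 (u, v) :=
        (isOpen_ne_fun continuous_fst continuous_snd).mem_nhds hne
      filter_upwards [self_mem_nhdsWithin, mem_nhdsWithin_of_mem_nhds hopen] with p hp hpne
      exact ⟨hp.1, hp.2.1, hp.2.2.1, hp.2.2.2.resolve_right hpne⟩

end ConvexCone

/-! ### Homogenization and construction of `Φ` -/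

/-- A point of `[u, v]` before `(1 - s) u + s v` lies between `u` and that point. -/
theorem exists_combo_eq_combo {V : Type*} [AddCommGroup V] [Module ℝ V] (u v : V) {r s : ℝ}
    (hr : 0 ≤ r) (hrs : r ≤ s) :
    ∃ t ∈ Icc (0 : ℝ) 1, (1 - r) • u + r • v = (1 - t) • u + t • ((1 - s) • u + s • v) := by
  rcases (hr.trans hrs).eq_or_lt with h | h
  · obtain rfl : r = 0 := by linarith
    exact ⟨0, ⟨le_rfl, zero_le_one⟩, by simp⟩
  · refine ⟨r / s, ⟨by positivity, (div_le_one h).2 hrs⟩, ?_⟩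
    have e : r = r / s * s := by field_simp
    generalize r / s = t at e
    subst e
    module

/-- Every convex subset of a two-dimensional normed space is compactly convex. -/
theorem Convex.isCompactlyConvex_of_finrank_eq_two {E : Type*} [NormedAddCommGroup E]
    [NormedSpace ℝ E] (hdim : Module.finrank ℝ E = 2) {C : Set E} (hC : Convex ℝ C) :
    IsCompactlyConvex C := by
  refine ⟨hC, ?_⟩
  rcases C.eq_empty_or_nonempty with rfl | ⟨x₀, hx₀⟩
  · exact ⟨fun x => x.2.elim, continuous_of_const fun x => x.2.elim, fun x => x.2.elim⟩
  have : FiniteDimensional ℝ E := .of_finrank_pos (by omega)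
  have : ProperSpace (E × ℝ) := FiniteDimensional.proper ℝ _
  have hconv : Convex ℝ (C ×ˢ {(1 : ℝ)}) := hC.prod (convex_singleton 1)
  obtain ⟨K, hKdef⟩ : ∃ K : ConvexCone ℝ (E × ℝ), K = ConvexCone.hull ℝ (C ×ˢ {(1 : ℝ)}) := ⟨_, rfl⟩
  have hK : ∀ p : E × ℝ, p ∈ K → 0 < p.2 ∧ p.2⁻¹ • p.1 ∈ C := by
    intro p hp
    rw [hKdef, ConvexCone.mem_hull_of_convex hconv] at hp
    obtain ⟨c, hc, ⟨y, t⟩, ⟨hy, ht⟩, rfl⟩ := hp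
    obtain rfl : t = 1 := ht
    simpa [hc, smul_smul, hc.ne'] using! hy
  have hKcl : ∀ p ∈ closure (K : Set (E × ℝ)), 0 ≤ p.2 := fun p hp =>
    closure_minimal (fun q hq => (hK q hq).1.le) (isClosed_Ici.preimage continuous_snd) hp
  have hCK : ∀ x ∈ C, ((x, 1) : E × ℝ) ∈ K := fun x hx => by
    rw [hKdef]; exact ConvexCone.subset_hull ⟨hx, rfl⟩
  have hnorm : ∀ x : E, 0 < ‖((x, 1) : E × ℝ)‖ := fun x => norm_pos_iff.2 (by simp)
  let n : E → E × ℝ := fun x => ‖((x, 1) : E × ℝ)‖⁻¹ • (x, 1)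
  have hnc : Continuous n := by
    have h1 : Continuous fun x : E => ((x, 1) : E × ℝ) := by fun_prop
    exact (h1.norm.inv₀ fun x => (hnorm x).ne').smul h1
  have hnK : ∀ x ∈ C, n x ∈ K := fun x hx => K.smul_mem (inv_pos.2 (hnorm x)) (hCK x hx)
  have hn1 : ∀ x, ‖n x‖ = 1 := fun x => by
    simp only [n]
    rw [norm_smul, norm_inv, norm_norm, inv_mul_cancel₀ (hnorm x).ne']
  let Y : Set (E × ℝ) := closure (K : Set (E × ℝ)) ∩ Metric.sphere 0 1
  have hYc : CompactSpace Y :=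
    isCompact_iff_compactSpace.1 ((isCompact_sphere _ _).inter_left isClosed_closure)
  have hnY : ∀ x ∈ C, n x ∈ Y := fun x hx =>
    ⟨subset_closure (hnK x hx), by simpa using hn1 x⟩
  have hYne : Nonempty Y := ⟨⟨n x₀, hnY x₀ hx₀⟩⟩
  -- Dependent unit vectors are equal or opposite; opposite is impossible, as `n x` has positive
  -- height and `v` nonnegative height.
  have hdom : ∀ x ∈ C, ∀ v ∈ Y, (n x, v) ∈ K.selectionDomain := by
    intro x hx v hv
    refine ⟨subset_closure (hnK x hx), hv.1, Or.inl (hnK x hx), ?_⟩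
    rw [or_iff_not_imp_right]
    intro hne
    refine (LinearIndependent.pair_iff' (norm_pos_iff.1 (by rw [hn1]; exact one_pos))).2 ?_
    intro a (ha : a • n x = v)
    have hv1 : ‖v‖ = 1 := by simpa using hv.2
    have habs : |a| = 1 := by
      rw [← hv1, ← ha, norm_smul, hn1, mul_one, Real.norm_eq_abs]
    rcases eq_or_eq_neg_of_abs_eq habs with rfl | rfl
    · exact hne (by simpa using ha)
    · have h1 := hKcl v hv.1
      have h2 := (hK _ (hnK x hx)).1
      rw [← ha] at h1
      simp only [neg_smul, one_smul, Prod.snd_neg] at h1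
      linarith
  obtain ⟨M, hMsymm, hMseg, hMK, hMc⟩ := K.exists_symmetric_selection (by simp [hdim])
  let Q : C → Icc (0 : ℝ) 1 × Y → E × ℝ := fun x z =>
    (1 - (z.1 : ℝ)) • n x + (z.1 : ℝ) • M (n x) z.2
  have hQK : ∀ x z, Q x z ∈ K := fun x z =>
    K.convex (hnK x x.2) (hMK _ _ (hdom x x.2 z.2 z.2.2)) (by linarith [z.1.2.2]) z.1.2.1 (by ring)
  have hQc : Continuous (Function.uncurry Q) := by
    have h1 : Continuous fun p : C × (Icc (0 : ℝ) 1 × Y) => (p.2.1 : ℝ) := by fun_prop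
    have h2 : Continuous fun p : C × (Icc (0 : ℝ) 1 × Y) => n p.1 := by fun_prop
    have h3 : Continuous fun p : C × (Icc (0 : ℝ) 1 × Y) => M (n p.1) p.2.2 :=
      hMc.comp_continuous (f := fun p : C × (Icc (0 : ℝ) 1 × Y) => (n p.1, (p.2.2 : E × ℝ)))
        (by fun_prop) fun p => hdom p.1 p.1.2 p.2.2 p.2.2.2
    exact ((continuous_const.sub h1).smul h2).add (h1.smul h3)
  let G : C → Icc (0 : ℝ) 1 × Y → C := fun x z => ⟨(Q x z).2⁻¹ • (Q x z).1, (hK _ (hQK x z)).2⟩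
  have hGc : Continuous (Function.uncurry G) := by
    refine Continuous.subtype_mk (((continuous_snd.comp hQc).inv₀ fun p => ?_).smul
      (continuous_fst.comp hQc)) _
    exact (hK _ (hQK p.1 p.2)).1.ne'
  obtain ⟨Φ, hΦc, hΦ⟩ := TopologicalSpace.NonemptyCompacts.exists_continuous_range hGc
  have hcover : ∀ x y : C, ∀ (z : E) (S r s : ℝ), 0 < S → 0 ≤ r → r ≤ s →
      M (n x) (n y) = (1 - s) • n x + s • n y →
      ((z, 1) : E × ℝ) = S • ((1 - r) • n x + r • n y) → z ∈ Subtype.val '' (Φ x : Set C) := by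
    intro x y z S r s hS hr hrs hM hz
    obtain ⟨t, ht, hte⟩ := exists_combo_eq_combo (n x) (n y) hr hrs
    rw [hte, ← hM] at hz
    refine ⟨G x ⟨⟨t, ht⟩, ⟨n y, hnY y y.2⟩⟩, by rw [hΦ]; exact mem_range_self _, ?_⟩
    have hQ : Q x ⟨⟨t, ht⟩, ⟨n y, hnY y y.2⟩⟩ = S⁻¹ • ((z, 1) : E × ℝ) := by
      rw [hz, smul_smul, inv_mul_cancel₀ hS.ne', one_smul]
    simp only [G, hQ]
    simp [smul_smul, hS.ne']
  refine ⟨Φ, hΦc, fun x y z hz => ?_⟩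
  obtain ⟨a, b, ha, hb, hab, rfl⟩ := hz
  obtain ⟨s, hs, hsM⟩ := hMseg (n x) (n y)
  obtain ⟨c, hc⟩ : ∃ c, c = ‖(((x : E), 1) : E × ℝ)‖ := ⟨_, rfl⟩
  obtain ⟨d, hd⟩ : ∃ d, d = ‖(((y : E), 1) : E × ℝ)‖ := ⟨_, rfl⟩
  have hc0 : 0 < c := hc ▸ hnorm x
  have hd0 : 0 < d := hd ▸ hnorm y
  have hcx : (((x : E), 1) : E × ℝ) = c • n x := by
    simp only [n]
    rw [← hc, smul_smul, mul_inv_cancel₀ hc0.ne', one_smul]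
  have hdy : (((y : E), 1) : E × ℝ) = d • n y := by
    simp only [n]
    rw [← hd, smul_smul, mul_inv_cancel₀ hd0.ne', one_smul]
  have hS : 0 < a * c + b * d := by
    rcases ha.eq_or_lt with h | h
    · rw [← h] at hab ⊢
      have : 0 < b := by linarith
      positivity
    · positivity
  have hz : ((a • (x : E) + b • (y : E), 1) : E × ℝ) = (a * c) • n x + (b * d) • n y := by
    rw [mul_smul, mul_smul, ← hcx, ← hdy]
    ext <;> simp [hab]
  -- Normalization changes the weights `a`, `b` to `a * c`, `b * d`; dividing by their sum `S` gives
  -- the position `r` on `[n x, n y]`, to be compared with that of `M`.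
  obtain ⟨S, hSdef⟩ : ∃ S, S = a * c + b * d := ⟨_, rfl⟩
  rw [← hSdef] at hS
  have e : S * (b * d / S) = b * d := by field_simp
  have hr0 : 0 ≤ b * d / S := by positivity
  have hr1 : b * d / S ≤ 1 := by
    rw [div_le_one hS, hSdef]
    have : 0 ≤ a * c := by positivity
    linarith
  generalize b * d / S = r at e hr0 hr1
  rw [show a * c = S - S * r by linarith, ← e] at hz
  rcases le_total r s with h | h
  · refine Or.inl (hcover x y _ S r s hS hr0 h hsM ?_)
    rw [hz]; module
  · refine Or.inr (hcover y x _ S (1 - r) (1 - s) hS (by linarith) (by linarith) ?_ ?_)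
    · rw [hMsymm, hsM]; module
    · rw [hz]; module

theorem theorem1 (C : Set (EuclideanSpace ℝ (Fin 2))) (hC : Convex ℝ C) :
    IsCompactlyConvex C := by
  exact hC.isCompactlyConvex_of_finrank_eq_two (by simp)
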